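/- **Conventions.** For a ribbon category $\mathcal C$ over $\mathbb C$ (a $\mathbb C$-linear rigid braided monoidal category with a twist) and an object $X$ with a chosen isomorphism $X\cong X^*$, let $\mathrm{cap}\colon X\otimes X\to \mathbf 1$ and $\mathrm{cup}\colon \mathbf 1\to X\otimes X$ be the resulting evaluation and coevaluation, and let the $n$-box space be $\mathcal C(n)=\mathrm{Hom}(X^{\otimes n},\mathbf 1)$. A *trivalent ribbon category* $(\mathcal C,X,\tau)$ over $\mathbb C$ is such a category with $\tau\in\mathcal C(3)$ satisfying: - $\mathcal C(1)=0$, and $\mathcal C(0),\mathcal C(2),\mathcal C(3)$ are one-dimensional, spanned respectively by $\mathrm{id}_{\mathbf 1}$ (the empty diagram), $\mathrm{cap}$ (the strand) and $\tau$ (the trivalent vertex); - every morphism between tensor powers of $X$ is a linear combination of diagrams built from $\tau$, cups, caps and crossings (that is, $\mathcal C$ is generated by $\tau$); - the circle and the bigon (defined below) are non-zero multiples of $\mathrm{id}_{\mathbf 1}$ and of $\mathrm{id}_X$. Write $m\colon X\otimes X\to X$ and $\Delta\colon X\to X\otimes X$ for $\tau$ with its last leg, respectively its last two legs, bent up on the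 right by cups. Let $\sigma\colon X\otimes X\to X\otimes X$ be the negative crossing (the inverse of the braiding). Put $$I=\Delta\circ m,\qquad H=(\mathrm{id}_X\otimes m)\circ(\Delta\otimes \mathrm{id}_X),\qquad K=H\circ\sigma$$ (diagrams shaped like the letter I, like the letter H, and like H with two crossed legs), and write $[n]=v^n-v^{-n}$, $\{n\}=v^n+v^{-n}$. **Theorem.** Let $(\mathcal C,X,\tau)$ be a trivalent ribbon category over $\mathbb C$ with $\dim\mathcal C(4)\le 5$. Then there exist $v,\alpha,b,d,t\in\mathbb C$ with $v\ne0$ such that the following relations hold: - circle, lollipop, bigon: $\ \mathrm{cap}\circ\mathrm{cup}=d\cdot\mathrm{id}_{\mathbf 1},\quad m\circ\mathrm{cup}=0,\quad m\circ\Delta=b\cdot\mathrm{id}_X$; - triangle: $\ m\circ H=t\,m$; - twists: $\ m\circ\sigma=-v^6\,m,\quad \sigma\circ\mathrm{cup}=v^{12}\,\mathrm{cup}$; - $[5]\,b=-\alpha\,(d+\{8\})$ and $\{2\}\,t=b-[5]\,\alpha$; - the quantum exceptional Jacobi relation in $\mathrm{End}(X\otimes X)$: $$v^{-3}K+v\,I-v^{-1}H+\alpha\left[\sigma+v^{4}\,\mathrm{cup}\circ\mathrm{cap}+v^{-4}\,\mathrm{id}_{X\otimes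 X}\right]=0 .$$ -/

import Mathlib

open CategoryTheory MonoidalCategory

universe w₁ w₂

namespace QuantumExceptional

/-- A ribbon structure on a rigid braided monoidal category (left duals are available through the
braiding): a twist, that is a natural automorphism `θ` of the identity functor such that
`θ_{X ⊗ Y}` is the double braiding composed with `θ_X ⊗ θ_Y`, and the twist of the dual is the
dual of the twist. -/
class RibbonCategory (C : Type w₁) [Category.{w₂} C] [MonoidalCategory C] [BraidedCategory C]
    [RightRigidCategory C] where
  /-- the twist -/
  twist : 𝟭 C ≅ 𝟭 C
  twist_tensor : ∀ X Y : C,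
    twist.hom.app (X ⊗ Y) =
      (twist.hom.app X ⊗ₘ twist.hom.app Y) ≫ (β_ X Y).hom ≫ (β_ Y X).hom
  twist_dual : ∀ X : C, twist.hom.app (Xᘁ) = (twist.hom.app X)ᘁ

section Boxes

variable {C : Type w₁} [Category.{w₂} C] [MonoidalCategory C]

/-- Tensor powers: `𝟙`, `X`, `X ⊗ X`, `(X ⊗ X) ⊗ X`, … -/
@[reducible]
def tensorPower (X : C) : ℕ → C
  | 0 => 𝟙_ C
  | 1 => X
  | n + 2 => tensorPower X (n + 1) ⊗ X

/-- The `n`-box space: all morphisms from `n` strands to the unit object. -/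
abbrev Box (X : C) (n : ℕ) : Type w₂ := tensorPower X n ⟶ 𝟙_ C

/-- Bracketings of tensor products of finitely many strands. -/
inductive Word : Type
  | empty : Word
  | strand : Word
  | tensor (a b : Word) : Word

/-- The object of `C` described by a word. -/
@[reducible]
def Word.obj (X : C) : Word → C
  | .empty => 𝟙_ C
  | .strand => X
  | .tensor a b => Word.obj X a ⊗ Word.obj X b

end Boxes

/-- A vector of a complex vector space that freely generates it as a module of rank one. -/
def FreelyGenerates {V : Type*} [AddCommGroup V] [Module ℂ V] (g : V) : Prop :=
  Function.Bijective (fun c : ℂ => c • g)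

/-- An object `X` with the data needed to read unoriented trivalent graphs as morphisms: a
self-duality of `X` and a trivalent vertex in the `3`-box space. -/
structure VertexData (C : Type w₁) [Category.{w₂} C] [MonoidalCategory C]
    [RightRigidCategory C] where
  /-- the object labelling a strand -/
  X : C
  /-- the self-duality, used for unoriented cups and caps -/
  selfDual : X ≅ Xᘁ
  /-- the trivalent vertex -/
  τ : Box X 3

/-! Diagrams are read from bottom to top: the source of a morphism is the bottom boundary of its
diagram and the target is the top boundary. -/

namespace VertexData

variable {C : Type w₁} [Category.{w₂} C] [MonoidalCategory C] [RightRigidCategory C]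
variable (D : VertexData C)

/-- The cap `X ⊗ X ⟶ 𝟙`. -/
def cap : D.X ⊗ D.X ⟶ 𝟙_ C :=
  (D.selfDual.hom ▷ D.X) ≫ (ε_ D.X (D.Xᘁ))

/-- The cup `𝟙 ⟶ X ⊗ X`. -/
def cup : 𝟙_ C ⟶ D.X ⊗ D.X :=
  (η_ D.X (D.Xᘁ)) ≫ (D.X ◁ D.selfDual.inv)

/-- The trivalent vertex with two legs at the bottom and one at the top: the last leg of `τ` is
bent upwards on the right. -/
def merge : D.X ⊗ D.X ⟶ D.X :=
  (ρ_ (D.X ⊗ D.X)).inv ≫ ((D.X ⊗ D.X) ◁ D.cup) ≫ (α_ (D.X ⊗ D.X) D.X D.X).inv ≫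
    (D.τ ▷ D.X) ≫ (λ_ D.X).hom

/-- The trivalent vertex with one leg at the bottom and two at the top: the last two legs of `τ`
are bent upwards on the right. -/
def split : D.X ⟶ D.X ⊗ D.X :=
  (ρ_ D.X).inv ≫ (D.X ◁ D.cup) ≫ (α_ D.X D.X D.X).inv ≫ (D.merge ▷ D.X)

/-- The circle (unknot). -/
def circle : 𝟙_ C ⟶ 𝟙_ C := D.cup ≫ D.cap

/-- The lollipop: a vertex, two of whose legs are joined to form a loop. -/
def lollipop : 𝟙_ C ⟶ D.X := D.cup ≫ D.merge

/-- The bigon, with one leg at the bottom and one at the top. -/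
def bigon : D.X ⟶ D.X := D.split ≫ D.merge

/-- The diagram shaped like the letter I: two bottom legs meet in a vertex, which is joined by a
vertical edge to a vertex with two top legs. -/
def diagramI : D.X ⊗ D.X ⟶ D.X ⊗ D.X := D.merge ≫ D.split

/-- The diagram shaped like the letter H: two vertical strands joined by a rung. -/
def diagramH : D.X ⊗ D.X ⟶ D.X ⊗ D.X :=
  (D.split ▷ D.X) ≫ (α_ D.X D.X D.X).hom ≫ (D.X ◁ D.merge)

/-- The triangle, with two legs at the bottom and one at the top. -/
def triangle : D.X ⊗ D.X ⟶ D.X := D.diagramH ≫ D.merge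

/-- The cup-cap diagram: a cap joining the bottom points, below a cup joining the top points. -/
def cupcap : D.X ⊗ D.X ⟶ D.X ⊗ D.X := D.cap ≫ D.cup

variable [BraidedCategory C]

/-- The negative crossing. -/
def crossing : D.X ⊗ D.X ⟶ D.X ⊗ D.X := (β_ D.X D.X).inv

/-- The cup with its ends crossed, a kink in the strand. -/
def twistedCup : 𝟙_ C ⟶ D.X ⊗ D.X := D.cup ≫ D.crossing

/-- The trivalent vertex with its two bottom legs crossed. -/
def twistedVertex : D.X ⊗ D.X ⟶ D.X := D.crossing ≫ D.merge

/-- The H-shaped diagram with its bottom legs crossed, the third term of the Jacobi relation. -/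
def diagramX : D.X ⊗ D.X ⟶ D.X ⊗ D.X := D.crossing ≫ D.diagramH

variable [Preadditive C] [Linear ℂ C]

/-- The morphisms between tensor products of strands that are complex linear combinations of
unoriented knotted trivalent graphs: those obtained from the vertex, the cup, the cap and the two
crossings by linear combinations, composition and tensor product. -/
inductive Generated : ∀ a b : Word, (a.obj D.X ⟶ b.obj D.X) → Prop
  | zero (a b : Word) : Generated a b 0
  | add {a b : Word} {f g : a.obj D.X ⟶ b.obj D.X} :
      Generated a b f → Generated a b g → Generated a b (f + g)
  | smul {a b : Word} (c : ℂ) {f : a.obj D.X ⟶ b.obj D.X} :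
      Generated a b f → Generated a b (c • f)
  | id (a : Word) : Generated a a (𝟙 (a.obj D.X))
  | comp {a b c : Word} {f : a.obj D.X ⟶ b.obj D.X} {g : b.obj D.X ⟶ c.obj D.X} :
      Generated a b f → Generated b c g → Generated a c (f ≫ g)
  | tensor {a b a' b' : Word} {f : a.obj D.X ⟶ b.obj D.X} {g : a'.obj D.X ⟶ b'.obj D.X} :
      Generated a b f → Generated a' b' g → Generated (a.tensor a') (b.tensor b') (f ⊗ₘ g)
  | assoc (a b c : Word) :
      Generated ((a.tensor b).tensor c) (a.tensor (b.tensor c))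
        (α_ (a.obj D.X) (b.obj D.X) (c.obj D.X)).hom
  | assoc_inv (a b c : Word) :
      Generated (a.tensor (b.tensor c)) ((a.tensor b).tensor c)
        (α_ (a.obj D.X) (b.obj D.X) (c.obj D.X)).inv
  | leftUnitor (a : Word) : Generated (Word.empty.tensor a) a (λ_ (a.obj D.X)).hom
  | leftUnitor_inv (a : Word) : Generated a (Word.empty.tensor a) (λ_ (a.obj D.X)).inv
  | rightUnitor (a : Word) : Generated (a.tensor Word.empty) a (ρ_ (a.obj D.X)).hom
  | rightUnitor_inv (a : Word) : Generated a (a.tensor Word.empty) (ρ_ (a.obj D.X)).inv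
  | braiding : Generated (Word.strand.tensor Word.strand) (Word.strand.tensor Word.strand)
      (β_ D.X D.X).hom
  | braiding_inv : Generated (Word.strand.tensor Word.strand) (Word.strand.tensor Word.strand)
      (β_ D.X D.X).inv
  | cap : Generated (Word.strand.tensor Word.strand) Word.empty D.cap
  | cup : Generated Word.empty (Word.strand.tensor Word.strand) D.cup
  | vertex : Generated ((Word.strand.tensor Word.strand).tensor Word.strand) Word.empty D.τ

end VertexData

/-- A trivalent ribbon category over `ℂ`: the `1`-box space vanishes; the `0`-, `2`- and `3`-box
spaces are freely generated by the empty diagram, the strand and the trivalent vertex; all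
morphisms between tensor powers of `X` are linear combinations of knotted trivalent graphs; the
circle and the bigon are non-zero multiples of the empty diagram and of the strand. -/
structure TrivalentRibbonCategory (C : Type w₁) [Category.{w₂} C] [Preadditive C] [Linear ℂ C]
    [MonoidalCategory C] [MonoidalPreadditive C] [MonoidalLinear ℂ C] [BraidedCategory C]
    [RightRigidCategory C] [RibbonCategory C] extends VertexData C where
  box_zero : FreelyGenerates (V := Box X 0) (𝟙 (𝟙_ C))
  box_one : ∀ f : Box X 1, f = 0
  box_two : FreelyGenerates (V := Box X 2) toVertexData.cap
  box_three : FreelyGenerates (V := Box X 3) τ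
  generated : ∀ (a b : Word) (f : a.obj X ⟶ b.obj X), toVertexData.Generated a b f
  circle_ne_zero : ∃ d : ℂ, d ≠ 0 ∧ toVertexData.circle = d • 𝟙 (𝟙_ C)
  bigon_ne_zero : ∃ b : ℂ, b ≠ 0 ∧ toVertexData.bigon = b • 𝟙 X

/-- The bracket `[n] = vⁿ - v⁻ⁿ`, without a denominator. -/
noncomputable def qBracket (v : ℂ) (n : ℤ) : ℂ := v ^ n - v ^ (-n)

/-- The brace `{n} = vⁿ + v⁻ⁿ`. -/
noncomputable def qBrace (v : ℂ) (n : ℤ) : ℂ := v ^ n + v ^ (-n)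

end QuantumExceptional

open QuantumExceptional

/-! The six diagrams `1`, `σ`, `cup ∘ cap`, `K`, `I`, `H` live in `End(X ⊗ X)`, which embeds in the
4-box space by bending legs and so has dimension at most 5. Composing with the braiding and then
making a quarter turn gives a linear operator that permutes the six up to scalars in two cycles, `1
→ σ → cup ∘ cap → 1` and `K → I → H → K`. If `c` is the factor of the twisted vertex, the cube of
the operator is `c⁻²` on both cycles. The coefficient vectors of linear relations form a non-zero
subspace of `ℂ⁶` stable under the lifted operator, which therefore contains an eigenvector
(`exists_twisted_relation`). Its eigenvalue `l` satisfies `c² l³ = 1`, and `v² = -c l` gives `c =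
-v⁶` and `l = v⁻⁴`. The eigenvector equations then fix the coefficients of the Jacobi relation, up
to the ratio of its two halves.

The permutation is exact only if the vertex is rotation invariant and a kink costs `c²`. Both follow
by sliding vertices past the two crossings (`RotatesBy.pow_three`, `RotatesBy.mul_eq`,
`exists_hasScalars`).

If the half with vertices has coefficient zero, `σ` is a combination of `1` and `cup ∘ cap`. Then
`v¹⁰ = 1`, and expanding crossings shows that the half with vertices vanishes by itself, so `α = 0`
works (`exceptional_relation_of_planar`). The two scalar equations come from closing the relation
with a cup and with a vertex (`closures`). -/

namespace QuantumExceptional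

namespace VertexData

/-! ### Planar calculus: self-duality, bending and diagrams beside a spectator object -/

section Planar

variable {C : Type w₁} [Category.{w₂} C] [MonoidalCategory C] [RightRigidCategory C]
variable (D : VertexData C)

theorem whiskerLeft_cup_cap :
    D.X ◁ D.cup ≫ (α_ _ _ _).inv ≫ D.cap ▷ D.X = (ρ_ D.X).hom ≫ (λ_ D.X).inv := by
  have h := ExactPairing.coevaluation_evaluation D.X (D.Xᘁ)
  calc
    _ = D.selfDual.hom ▷ 𝟙_ C ≫ ((D.Xᘁ) ◁ η_ D.X (D.Xᘁ) ≫ (α_ _ _ _).inv ≫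
          ε_ D.X (D.Xᘁ) ▷ (D.Xᘁ)) ≫ 𝟙_ C ◁ D.selfDual.inv := by
      simp only [cup, cap, comp_whiskerRight]
      rw [← associator_inv_naturality_left_assoc, whisker_exchange_assoc]
      simp only [MonoidalCategory.whiskerLeft_comp, Category.assoc]
      rw [associator_inv_naturality_right_assoc, whisker_exchange]
    _ = _ := by
      rw [h]
      simp

theorem cup_whiskerRight_cap :
    D.cup ▷ D.X ≫ (α_ _ _ _).hom ≫ D.X ◁ D.cap = (λ_ D.X).hom ≫ (ρ_ D.X).inv := by
  have h := ExactPairing.evaluation_coevaluation D.X (D.Xᘁ)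
  rw [← h]
  simp only [cup, cap, MonoidalCategory.whiskerLeft_comp, comp_whiskerRight, Category.assoc]
  simp only [← whiskerLeft_comp_assoc,
    associator_naturality_middle_assoc]
  simp

/-- The self-duality of the strand. -/
abbrev selfPairing : ExactPairing D.X D.X where
  coevaluation' := D.cup
  evaluation' := D.cap
  coevaluation_evaluation' := D.whiskerLeft_cup_cap
  evaluation_coevaluation' := D.cup_whiskerRight_cap

/-- Bend the last leg at the bottom to the top. -/
def bend (Y Z : C) : (Y ⊗ D.X ⟶ Z) ≃ (Y ⟶ Z ⊗ D.X) :=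
  letI := D.selfPairing
  tensorRightHomEquiv Y D.X D.X Z

theorem bend_apply {Y Z : C} (f : Y ⊗ D.X ⟶ Z) :
    D.bend Y Z f = (ρ_ _).inv ≫ Y ◁ D.cup ≫ (α_ _ _ _).inv ≫ f ▷ D.X := rfl

theorem bend_symm_apply {Y Z : C} (f : Y ⟶ Z ⊗ D.X) :
    (D.bend Y Z).symm f = f ▷ D.X ≫ (α_ _ _ _).hom ≫ Z ◁ D.cap ≫ (ρ_ _).hom := rfl

theorem merge_eq_bend : D.merge = D.bend (D.X ⊗ D.X) (𝟙_ C) D.τ ≫ (λ_ D.X).hom := by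
  simp [merge, bend_apply]

/-! A morphism between tensor powers of the strand acts on the strands at the left of an
object `A`.  Morphisms of this form compose without associators. -/

/-- The cap next to `A`. -/
def capAt (A : C) : D.X ⊗ (D.X ⊗ A) ⟶ A := (α_ _ _ _).inv ≫ D.cap ▷ A ≫ (λ_ A).hom

/-- The cup next to `A`. -/
def cupAt (A : C) : A ⟶ D.X ⊗ (D.X ⊗ A) := (λ_ A).inv ≫ D.cup ▷ A ≫ (α_ _ _ _).hom

/-- A morphism `X ⊗ X ⟶ X` next to `A`. -/
def mergeAt (f : D.X ⊗ D.X ⟶ D.X) (A : C) : D.X ⊗ (D.X ⊗ A) ⟶ D.X ⊗ A :=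
  (α_ _ _ _).inv ≫ f ▷ A

/-- A morphism `X ⟶ X ⊗ X` next to `A`. -/
def splitAt (f : D.X ⟶ D.X ⊗ D.X) (A : C) : D.X ⊗ A ⟶ D.X ⊗ (D.X ⊗ A) :=
  f ▷ A ≫ (α_ _ _ _).hom

/-- An endomorphism of `X ⊗ X` next to `A`. -/
def act (f : D.X ⊗ D.X ⟶ D.X ⊗ D.X) (A : C) : D.X ⊗ (D.X ⊗ A) ⟶ D.X ⊗ (D.X ⊗ A) :=
  (α_ _ _ _).inv ≫ f ▷ A ≫ (α_ _ _ _).hom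

theorem capAt_naturality {A B : C} (g : A ⟶ B) :
    D.X ◁ (D.X ◁ g) ≫ D.capAt B = D.capAt A ≫ g := by
  simp only [capAt, Category.assoc]
  rw [associator_inv_naturality_right_assoc, whisker_exchange_assoc, leftUnitor_naturality]

theorem cupAt_naturality {A B : C} (g : A ⟶ B) :
    D.cupAt A ≫ D.X ◁ (D.X ◁ g) = g ≫ D.cupAt B := by
  simp only [cupAt, Category.assoc]
  rw [← associator_naturality_right, ← whisker_exchange_assoc, leftUnitor_inv_naturality_assoc]

theorem mergeAt_naturality (f : D.X ⊗ D.X ⟶ D.X) {A B : C} (g : A ⟶ B) :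
    D.X ◁ (D.X ◁ g) ≫ D.mergeAt f B = D.mergeAt f A ≫ D.X ◁ g := by
  simp only [mergeAt, Category.assoc]
  rw [associator_inv_naturality_right_assoc, whisker_exchange]

theorem splitAt_naturality (f : D.X ⟶ D.X ⊗ D.X) {A B : C} (g : A ⟶ B) :
    D.splitAt f A ≫ D.X ◁ (D.X ◁ g) = D.X ◁ g ≫ D.splitAt f B := by
  simp [splitAt, whisker_exchange_assoc]

theorem act_naturality (f : D.X ⊗ D.X ⟶ D.X ⊗ D.X) {A B : C} (g : A ⟶ B) :
    D.act f A ≫ D.X ◁ (D.X ◁ g) = D.X ◁ (D.X ◁ g) ≫ D.act f B := by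
  simp only [act, Category.assoc]
  rw [associator_inv_naturality_right_assoc, whisker_exchange_assoc, associator_naturality_right]

@[simp]
theorem whiskerLeft_cupAt_capAt (A : C) :
    D.X ◁ D.cupAt A ≫ D.capAt (D.X ⊗ A) = 𝟙 _ := by
  have h := congrArg (fun f => (ρ_ D.X).inv ▷ A ≫ f ▷ A ≫ (λ_ D.X).hom ▷ A) D.whiskerLeft_cup_cap
  simp only [comp_whiskerRight, Category.assoc] at h
  simp only [cupAt, capAt]
  trans (ρ_ D.X).inv ▷ A ≫ (D.X ◁ D.cup) ▷ A ≫ (α_ _ _ _).inv ▷ A ≫ (D.cap ▷ D.X) ▷ A ≫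
    (λ_ D.X).hom ▷ A
  · monoidal
  · rw [h]; monoidal

@[simp]
theorem cupAt_whiskerLeft_capAt (A : C) :
    D.cupAt (D.X ⊗ A) ≫ D.X ◁ D.capAt A = 𝟙 _ := by
  have h := congrArg (fun f => (λ_ D.X).inv ▷ A ≫ f ▷ A ≫ (ρ_ D.X).hom ▷ A) D.cup_whiskerRight_cap
  simp only [comp_whiskerRight, Category.assoc] at h
  simp only [cupAt, capAt]
  trans (λ_ D.X).inv ▷ A ≫ (D.cup ▷ D.X) ▷ A ≫ (α_ _ _ _).hom ▷ A ≫ (D.X ◁ D.cap) ▷ A ≫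
    (ρ_ D.X).hom ▷ A
  · monoidal
  · rw [h]; monoidal

/-- With the spectator `A` absorbing associators, a split is a merge with one fresh cup on its
right; later proofs trade one form for the other. -/
theorem splitAt_split (A : C) :
    D.splitAt D.split A = D.X ◁ D.cupAt A ≫ D.mergeAt D.merge (D.X ⊗ A) := by
  simp only [splitAt, split, cupAt, mergeAt]
  monoidal

theorem act_comp (f g : D.X ⊗ D.X ⟶ D.X ⊗ D.X) (A : C) :
    D.act (f ≫ g) A = D.act f A ≫ D.act g A := by
  simp [act]

@[simp]
theorem act_id (A : C) : D.act (𝟙 _) A = 𝟙 _ := by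
  simp [act]

theorem act_cupcap (A : C) : D.act D.cupcap A = D.capAt A ≫ D.cupAt A := by
  simp [act, cupcap, capAt, cupAt]

theorem act_diagramI (A : C) :
    D.act D.diagramI A = D.mergeAt D.merge A ≫ D.splitAt D.split A := by
  simp [act, diagramI, mergeAt, splitAt]

theorem act_diagramH (A : C) :
    D.act D.diagramH A = D.splitAt D.split (D.X ⊗ A) ≫ D.X ◁ D.mergeAt D.merge A := by
  simp only [act, diagramH, mergeAt, splitAt]
  monoidal

theorem splitAt_mergeAt (f : D.X ⟶ D.X ⊗ D.X) (g : D.X ⊗ D.X ⟶ D.X) (A : C) :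
    D.splitAt f A ≫ D.mergeAt g A = (f ≫ g) ▷ A := by
  simp [mergeAt, splitAt]

theorem act_mergeAt (f : D.X ⊗ D.X ⟶ D.X ⊗ D.X) (g : D.X ⊗ D.X ⟶ D.X) (A : C) :
    D.act f A ≫ D.mergeAt g A = D.mergeAt (f ≫ g) A := by
  simp [mergeAt, act]

/-- Morphisms with a strand at the top left agree once that strand is bent down. -/
theorem capAt_cancel {A B : C} {g h : A ⟶ D.X ⊗ B}
    (e : D.X ◁ g ≫ D.capAt B = D.X ◁ h ≫ D.capAt B) : g = h := by
  have key : ∀ u : A ⟶ D.X ⊗ B, u = D.cupAt A ≫ D.X ◁ (D.X ◁ u ≫ D.capAt B) := by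
    intro u
    rw [MonoidalCategory.whiskerLeft_comp, reassoc_of% D.cupAt_naturality, cupAt_whiskerLeft_capAt,
      Category.comp_id]
  rw [key g, key h, e]

end Planar

/-! ### Sliding past a crossing -/

section Crossing

variable {C : Type w₁} [Category.{w₂} C] [MonoidalCategory C] [RightRigidCategory C]
variable (D : VertexData C)

/-- Endomorphisms of `X ⊗ X` past which merges, splits and the cap slide, as past a crossing. -/
structure IsCrossing (x : D.X ⊗ D.X ⟶ D.X ⊗ D.X) : Prop where
  merge_slide : ∀ f : D.X ⊗ D.X ⟶ D.X, D.X ◁ f ≫ x =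
    (α_ _ _ _).inv ≫ x ▷ D.X ≫ (α_ _ _ _).hom ≫ D.X ◁ x ≫ (α_ _ _ _).inv ≫ f ▷ D.X
  split_slide : ∀ f : D.X ⟶ D.X ⊗ D.X, x ≫ f ▷ D.X =
    D.X ◁ f ≫ (α_ _ _ _).inv ≫ x ▷ D.X ≫ (α_ _ _ _).hom ≫ D.X ◁ x ≫ (α_ _ _ _).inv
  cap_slide : D.X ◁ D.cap ≫ (ρ_ D.X).hom =
    (α_ _ _ _).inv ≫ x ▷ D.X ≫ (α_ _ _ _).hom ≫ D.X ◁ x ≫ (α_ _ _ _).inv ≫ D.cap ▷ D.X ≫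
      (λ_ D.X).hom

variable {D} {x : D.X ⊗ D.X ⟶ D.X ⊗ D.X} (hx : D.IsCrossing x)

include hx in
theorem IsCrossing.mergeAt_act (f : D.X ⊗ D.X ⟶ D.X) (A : C) :
    D.X ◁ D.mergeAt f A ≫ D.act x A =
      D.act x (D.X ⊗ A) ≫ D.X ◁ D.act x A ≫ D.mergeAt f (D.X ⊗ A) := by
  have h := congrArg (fun g => g ▷ A) (hx.merge_slide f)
  simp only [comp_whiskerRight, whisker_assoc, Category.assoc] at h
  simp only [mergeAt, act, MonoidalCategory.whiskerLeft_comp]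
  trans D.X ◁ (α_ _ _ _).inv ≫ (α_ _ _ _).inv ≫ ((α_ _ _ _).hom ≫ D.X ◁ f ▷ A ≫
    (α_ _ _ _).inv ≫ x ▷ A) ≫ (α_ _ _ _).hom
  · monoidal
  · rw [h]; monoidal

include hx in
theorem IsCrossing.act_splitAt (f : D.X ⟶ D.X ⊗ D.X) (A : C) :
    D.act x A ≫ D.splitAt f (D.X ⊗ A) =
      D.X ◁ D.splitAt f A ≫ D.act x (D.X ⊗ A) ≫ D.X ◁ D.act x A := by
  have h := congrArg (fun g => g ▷ A) (hx.split_slide f)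
  simp only [comp_whiskerRight, whisker_assoc, Category.assoc] at h
  simp only [splitAt, act, MonoidalCategory.whiskerLeft_comp]
  trans (α_ _ _ _).inv ≫ (x ▷ A ≫ f ▷ D.X ▷ A) ≫ (α_ _ _ _).hom ≫ (α_ _ _ _).hom
  · monoidal
  · rw [h]; monoidal

include hx in
theorem IsCrossing.whiskerLeft_capAt (A : C) :
    D.X ◁ D.capAt A = D.act x (D.X ⊗ A) ≫ D.X ◁ D.act x A ≫ D.capAt (D.X ⊗ A) := by
  have h := congrArg (fun g => g ▷ A) hx.cap_slide
  simp only [comp_whiskerRight, whisker_assoc, Category.assoc] at h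
  simp only [capAt, act, MonoidalCategory.whiskerLeft_comp]
  trans D.X ◁ (α_ _ _ _).inv ≫ (α_ _ _ _).inv ≫ ((α_ _ _ _).hom ≫ D.X ◁ D.cap ▷ A ≫
    (α_ _ _ _).inv ≫ (ρ_ _).hom ▷ A)
  · monoidal
  · rw [h]; monoidal

variable (D) [BraidedCategory C]

/-- Naturality of the braiding and the hexagon. The inverse braiding satisfies the same rules, so
every consequence holds for both crossings. -/
theorem isCrossing_braiding : D.IsCrossing (β_ D.X D.X).hom where
  merge_slide f := by
    rw [BraidedCategory.braiding_naturality_right, BraidedCategory.braiding_tensor_right_hom]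
    simp
  split_slide f := by
    rw [← BraidedCategory.braiding_naturality_right, BraidedCategory.braiding_tensor_right_hom]
  cap_slide := by
    have h := BraidedCategory.braiding_naturality_right D.X D.cap
    rw [BraidedCategory.braiding_tensor_right_hom, braiding_tensorUnit_right] at h
    have h' := congrArg (fun g => g ≫ (λ_ D.X).hom) h
    simpa using h'

theorem isCrossing_braiding_inv : D.IsCrossing (β_ D.X D.X).inv where
  merge_slide f := by
    rw [BraidedCategory.braiding_inv_naturality_right, BraidedCategory.braiding_tensor_left_inv]
    simp
  split_slide f := by
    rw [← BraidedCategory.braiding_inv_naturality_right, BraidedCategory.braiding_tensor_left_inv]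
  cap_slide := by
    have h := BraidedCategory.braiding_inv_naturality_right D.X D.cap
    rw [BraidedCategory.braiding_tensor_left_inv, braiding_inv_tensorUnit_left] at h
    have h' := congrArg (fun g => g ≫ (λ_ D.X).hom) h
    simpa using h'

end Crossing

/-! ### Rotation of the vertex -/

section Rotation

variable {C : Type w₁} [Category.{w₂} C] [Preadditive C] [Linear ℂ C] [MonoidalCategory C]
  [MonoidalPreadditive C] [MonoidalLinear ℂ C] [RightRigidCategory C]
variable (D : VertexData C)

/-- The scalar by which the vertex is multiplied under rotation by a third of a turn. -/
def RotatesBy (ω : ℂ) : Prop :=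
  ∀ A : C, D.X ◁ D.mergeAt D.merge A ≫ D.capAt A = ω • D.mergeAt D.merge (D.X ⊗ A) ≫ D.capAt A

theorem capAt_smul_cancel (D : VertexData C) {A B : C} {g h : A ⟶ D.X ⊗ B} (r s : ℂ)
    (e : r • D.X ◁ g ≫ D.capAt B = s • D.X ◁ h ≫ D.capAt B) : r • g = s • h :=
  D.capAt_cancel (by simpa using e)

variable {D} {ω : ℂ} (hω : D.RotatesBy ω)

include hω in
omit [MonoidalPreadditive C] [MonoidalLinear ℂ C] in
theorem RotatesBy.whiskerLeft_splitAt_capAt (A : C) :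
    D.X ◁ D.splitAt D.split A ≫ D.capAt (D.X ⊗ A) = ω • D.mergeAt D.merge A := by
  rw [splitAt_split, MonoidalCategory.whiskerLeft_comp, Category.assoc, hω, Linear.comp_smul,
    reassoc_of% D.mergeAt_naturality, whiskerLeft_cupAt_capAt, Category.comp_id]

omit [Preadditive C] [Linear ℂ C] [MonoidalPreadditive C] [MonoidalLinear ℂ C] in
/-- Bending the other leg of the vertex. -/
theorem whiskerLeft_cupAt_merge_capAt (D : VertexData C) (A : C) :
    D.X ◁ (D.cupAt (D.X ⊗ A) ≫ D.X ◁ D.mergeAt D.merge A) ≫ D.capAt (D.X ⊗ A) =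
      D.mergeAt D.merge A := by
  rw [MonoidalCategory.whiskerLeft_comp, Category.assoc, capAt_naturality,
    reassoc_of% D.whiskerLeft_cupAt_capAt]

include hω in
theorem RotatesBy.splitAt_eq (A : C) :
    D.splitAt D.split A = ω • (D.cupAt (D.X ⊗ A) ≫ D.X ◁ D.mergeAt D.merge A) := by
  have := D.capAt_smul_cancel 1 ω (g := D.splitAt D.split A)
    (h := D.cupAt (D.X ⊗ A) ≫ D.X ◁ D.mergeAt D.merge A) (by
      rw [whiskerLeft_cupAt_merge_capAt, hω.whiskerLeft_splitAt_capAt, one_smul])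
  simpa using this

-- The rung of `H` may slant either way: turning both vertices exchanges the two drawings, at the
-- cost of `ω`.
include hω in
theorem RotatesBy.smul_act_diagramH (A : C) :
    ω • D.act D.diagramH A = D.X ◁ D.splitAt D.split A ≫ D.mergeAt D.merge (D.X ⊗ A) := by
  rw [act_diagramH, splitAt_split, hω.splitAt_eq]
  simp only [MonoidalLinear.whiskerLeft_smul, MonoidalCategory.whiskerLeft_comp, Linear.smul_comp,
    Category.assoc, mergeAt_naturality]

include hω in
/-- Rotating a bigon by half a turn rotates each of its vertices by half a turn. -/
theorem RotatesBy.pow_three {b : ℂ} (hb : b ≠ 0) (h : D.bigon = b • 𝟙 D.X)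
    (hcap : D.cap ≠ 0) : ω ^ 3 = 1 := by
  have hbig : ∀ A : C, D.splitAt D.split A ≫ D.mergeAt D.merge A = b • 𝟙 _ := by
    intro A
    have h' : D.split ≫ D.merge = b • 𝟙 D.X := h
    rw [splitAt_mergeAt, h']
    simp
  have h1 : ∀ A : C, b • D.capAt A =
      ω • D.X ◁ D.splitAt D.split A ≫ D.mergeAt D.merge (D.X ⊗ A) ≫ D.capAt A := by
    intro A
    have := congrArg (fun g => D.X ◁ g ≫ D.capAt A) (hbig A)
    simpa [hω A] using this.symm
  have h2 : ∀ A : C, (ω * b) • D.capAt A = D.act D.diagramH A ≫ D.capAt A := by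
    intro A
    have := congrArg (fun g => ω • g ≫ D.capAt A) (hbig (D.X ⊗ A))
    rw [act_diagramH, Category.assoc, hω A]
    simpa [smul_smul] using this.symm
  -- The bigon travels over the cap from its right end to its left end. Three vertex rotations occur
  -- on the way, each costing `ω`.
  have h3 : (ω ^ 3 * b) • D.capAt (𝟙_ C) = b • D.capAt (𝟙_ C) := by
    rw [h1, ← Category.assoc, ← hω.smul_act_diagramH, Linear.smul_comp, ← h2]
    simp only [smul_smul]
    congr 1
    ring
  have h4 : D.capAt (𝟙_ C) ≠ 0 := by
    intro h0
    apply hcap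
    simpa [capAt] using h0
  have h5 := smul_left_injective ℂ h4 h3
  exact mul_right_cancel₀ hb (by simpa using h5)

include hω in
/-- A vertex slides past a crossing: its rotation is a braiding of its legs, up to a twist. -/
theorem RotatesBy.mul_eq {x : D.X ⊗ D.X ⟶ D.X ⊗ D.X} (hx : D.IsCrossing x) {c k : ℂ}
    (hm : x ≫ D.merge = c • D.merge) (hc : x ≫ D.cap = k • D.cap)
    (hτ : D.mergeAt D.merge (D.X ⊗ 𝟙_ C) ≫ D.capAt (𝟙_ C) ≠ 0) (hω0 : ω ≠ 0) :
    k * ω = c ^ 2 := by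
  have hmA : ∀ A : C, D.act x A ≫ D.mergeAt D.merge A = c • D.mergeAt D.merge A := by
    intro A
    rw [act_mergeAt, hm]
    simp [mergeAt]
  have hcA : ∀ A : C, D.act x A ≫ D.capAt A = k • D.capAt A := by
    intro A
    have := congrArg (fun g => (α_ _ _ _).inv ≫ g ▷ A ≫ (λ_ A).hom) hc
    simpa [act, capAt] using this
  -- A crossing of the last two legs also contributes `c`: rotate the vertex so that these legs
  -- merge, then cancel `ω`.
  have h1 : ∀ A : C, D.X ◁ D.act x A ≫ D.mergeAt D.merge (D.X ⊗ A) ≫ D.capAt A =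
      c • D.mergeAt D.merge (D.X ⊗ A) ≫ D.capAt A := by
    intro A
    have h := congrArg (fun g => D.X ◁ g ≫ D.capAt A) (hmA A)
    simp only [MonoidalCategory.whiskerLeft_comp, Category.assoc, hω A,
      MonoidalLinear.whiskerLeft_smul, Linear.smul_comp, Linear.comp_smul] at h
    rw [smul_comm] at h
    exact smul_right_injective _ hω0 h
  -- A merge followed by a kinked cap, evaluated twice: removing the kink gives `k * ω`, and sliding
  -- the merge through the crossing leaves two crossings on the vertex, giving `c ^ 2`.
  have h2 := congrArg (fun g => D.X ◁ D.mergeAt D.merge (𝟙_ C) ≫ g) (hcA (𝟙_ C))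
  simp only [Linear.comp_smul, hω (𝟙_ C)] at h2
  rw [reassoc_of% hx.mergeAt_act, h1, Linear.comp_smul, ← Category.assoc, hmA, Linear.smul_comp,
    smul_smul, smul_smul] at h2
  have := smul_left_injective ℂ hτ h2
  rw [← this]; ring

end Rotation

/-! ### Quarter turns of endomorphisms of `X ⊗ X` -/

section Rotate

variable {C : Type w₁} [Category.{w₂} C] [Preadditive C] [Linear ℂ C] [MonoidalCategory C]
  [MonoidalPreadditive C] [MonoidalLinear ℂ C] [RightRigidCategory C]
variable (D : VertexData C)

/-- A quarter turn of an endomorphism of `X ⊗ X`, next to `A`. -/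
def rotateAt (f : D.X ⊗ D.X ⟶ D.X ⊗ D.X) (A : C) : D.X ⊗ (D.X ⊗ A) ⟶ D.X ⊗ (D.X ⊗ A) :=
  D.X ◁ (D.X ◁ D.cupAt A) ≫ D.X ◁ D.act f (D.X ⊗ A) ≫ D.capAt (D.X ⊗ (D.X ⊗ A))

/-- The quarter turn of endomorphisms of `X ⊗ X`. -/
def rotate : (D.X ⊗ D.X ⟶ D.X ⊗ D.X) →ₗ[ℂ] (D.X ⊗ D.X ⟶ D.X ⊗ D.X) where
  toFun f := ((ρ_ _).inv ≫ (α_ _ _ _).hom) ≫ D.rotateAt f (𝟙_ C) ≫ (α_ _ _ _).inv ≫ (ρ_ _).hom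
  map_add' f g := by
    simp [rotateAt, act]
  map_smul' r f := by
    simp [rotateAt, act]

variable {D}

theorem rotate_eq {f g : D.X ⊗ D.X ⟶ D.X ⊗ D.X} (h : ∀ A, D.rotateAt f A = D.act g A) :
    D.rotate f = g := by
  change ((ρ_ _).inv ≫ (α_ _ _ _).hom) ≫ D.rotateAt f (𝟙_ C) ≫ (α_ _ _ _).inv ≫ (ρ_ _).hom = g
  rw [h]
  simp only [act, Category.assoc, Iso.hom_inv_id_assoc, rightUnitor_naturality,
    Iso.inv_hom_id_assoc]

theorem rotate_id : D.rotate (𝟙 _) = D.cupcap := by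
  refine rotate_eq fun A => ?_
  rw [rotateAt, act_id, MonoidalCategory.whiskerLeft_id, Category.id_comp, capAt_naturality,
    act_cupcap]

theorem rotate_cupcap : D.rotate D.cupcap = 𝟙 _ := by
  refine rotate_eq fun A => ?_
  rw [rotateAt, act_cupcap, MonoidalCategory.whiskerLeft_comp, Category.assoc,
    whiskerLeft_cupAt_capAt, Category.comp_id, ← MonoidalCategory.whiskerLeft_comp,
    whiskerLeft_cupAt_capAt, MonoidalCategory.whiskerLeft_id, act_id]

/-- Pulling the cap across the strand replaces `x` by its inverse on the other side; the remaining
cup and cap straighten. -/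
theorem rotate_crossing_eq {x y : D.X ⊗ D.X ⟶ D.X ⊗ D.X} (hx : D.IsCrossing x)
    (hyx : y ≫ x = 𝟙 _) : D.rotate x = y := by
  refine rotate_eq fun A => ?_
  have h : D.X ◁ D.act x (D.X ⊗ A) ≫ D.capAt (D.X ⊗ (D.X ⊗ A)) =
      D.act y (D.X ⊗ (D.X ⊗ A)) ≫ D.X ◁ D.capAt (D.X ⊗ A) := by
    rw [hx.whiskerLeft_capAt, ← Category.assoc, ← act_comp, hyx, act_id, Category.id_comp]
  rw [rotateAt, h, ← reassoc_of% D.act_naturality, ← MonoidalCategory.whiskerLeft_comp,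
    whiskerLeft_cupAt_capAt, MonoidalCategory.whiskerLeft_id, Category.comp_id]

variable (hω : D.RotatesBy 1)

include hω

omit [MonoidalPreadditive C] [MonoidalLinear ℂ C] in
theorem RotatesBy.one_whiskerLeft_splitAt_capAt (A : C) :
    D.X ◁ D.splitAt D.split A ≫ D.capAt (D.X ⊗ A) = D.mergeAt D.merge A := by
  simpa using hω.whiskerLeft_splitAt_capAt A

theorem RotatesBy.one_act_diagramH (A : C) :
    D.act D.diagramH A = D.X ◁ D.splitAt D.split A ≫ D.mergeAt D.merge (D.X ⊗ A) := by
  simpa using hω.smul_act_diagramH A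

theorem RotatesBy.rotate_diagramI : D.rotate D.diagramI = D.diagramH := by
  refine rotate_eq fun A => ?_
  rw [rotateAt, act_diagramI, MonoidalCategory.whiskerLeft_comp, Category.assoc,
    hω.one_whiskerLeft_splitAt_capAt, ← whiskerLeft_comp_assoc, ← splitAt_split,
    hω.one_act_diagramH]

theorem RotatesBy.rotate_diagramH : D.rotate D.diagramH = D.diagramI := by
  refine rotate_eq fun A => ?_
  rw [rotateAt, act_diagramH, MonoidalCategory.whiskerLeft_comp, Category.assoc,
    capAt_naturality, reassoc_of% hω.one_whiskerLeft_splitAt_capAt,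
    reassoc_of% D.mergeAt_naturality,
    ← splitAt_split, act_diagramI]

/-- `H ∘ H` is a square with four legs, hence invariant under a quarter turn. -/
theorem RotatesBy.rotate_diagramH_comp_diagramH :
    D.rotate (D.diagramH ≫ D.diagramH) = D.diagramH ≫ D.diagramH := by
  refine rotate_eq fun A => ?_
  rw [rotateAt, act_comp, act_comp]
  conv_lhs => rw [act_diagramH]
  simp only [MonoidalCategory.whiskerLeft_comp, Category.assoc]
  rw [capAt_naturality, reassoc_of% hω.one_whiskerLeft_splitAt_capAt,
    reassoc_of% D.mergeAt_naturality,
    ← whiskerLeft_comp_assoc, ← splitAt_naturality, MonoidalCategory.whiskerLeft_comp,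
    Category.assoc, reassoc_of% D.mergeAt_naturality, ← whiskerLeft_comp_assoc _ (D.X ◁ D.cupAt A),
    ← splitAt_split, hω.one_act_diagramH, Category.assoc]

/-- Sliding the split of `H` through `x` makes two crossings. One is absorbed by the merge and
yields `c`; the other meets the cap and becomes `y`. -/
theorem RotatesBy.rotate_crossing_comp_diagramH {x y : D.X ⊗ D.X ⟶ D.X ⊗ D.X}
    (hx : D.IsCrossing x) (hyx : y ≫ x = 𝟙 _) {c : ℂ} (hc : x ≫ D.merge = c • D.merge) :
    D.rotate (x ≫ D.diagramH) = c • y ≫ D.diagramH := by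
  refine rotate_eq fun A => ?_
  have h : ∀ B, D.X ◁ D.act x B ≫ D.capAt (D.X ⊗ B) =
      D.act y (D.X ⊗ B) ≫ D.X ◁ D.capAt B := by
    intro B
    rw [hx.whiskerLeft_capAt, ← Category.assoc, ← act_comp, hyx, act_id, Category.id_comp]
  have hm : ∀ B, D.act x B ≫ D.mergeAt D.merge B = c • D.mergeAt D.merge B := by
    intro B
    rw [act_mergeAt, hc]
    simp [mergeAt]
  have hs : D.act (c • y ≫ D.diagramH) A = c • D.act y A ≫ D.act D.diagramH A := by
    rw [← act_comp]
    simp [act]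
  rw [rotateAt, act_comp, act_diagramH, reassoc_of% hx.act_splitAt,
    ← MonoidalCategory.whiskerLeft_comp, hm, hs, hω.one_act_diagramH]
  simp only [MonoidalLinear.whiskerLeft_smul, MonoidalCategory.whiskerLeft_comp, Linear.smul_comp,
    Linear.comp_smul, Category.assoc]
  rw [capAt_naturality, reassoc_of% (h (D.X ⊗ (D.X ⊗ A))), ← reassoc_of% D.act_naturality,
    ← reassoc_of% D.act_naturality,
    ← whiskerLeft_comp_assoc D.X _ (D.capAt _), hω.one_whiskerLeft_splitAt_capAt,
    ← whiskerLeft_comp_assoc, ← splitAt_split]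

theorem RotatesBy.diagramH_comp_cap {b : ℂ} (hb : D.bigon = b • 𝟙 D.X) :
    D.diagramH ≫ D.cap = b • D.cap := by
  have hb' : D.split ≫ D.merge = b • 𝟙 D.X := hb
  have h : D.act D.diagramH (𝟙_ C) ≫ D.capAt (𝟙_ C) = b • D.capAt (𝟙_ C) := by
    have := hω (𝟙_ C)
    rw [one_smul] at this
    rw [act_diagramH, Category.assoc, this, ← Category.assoc, splitAt_mergeAt, hb']
    simp
  have h' := congrArg (fun g => (ρ_ _).inv ≫ (α_ _ _ _).hom ≫ g) h
  simpa [act, capAt, unitors_equal] using h'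

theorem RotatesBy.cup_comp_diagramH {b : ℂ} (hb : D.bigon = b • 𝟙 D.X) :
    D.cup ≫ D.diagramH = b • D.cup := by
  have hb' : D.split ≫ D.merge = b • 𝟙 D.X := hb
  have h : D.cupAt (𝟙_ C) ≫ D.act D.diagramH (𝟙_ C) = b • D.cupAt (𝟙_ C) := by
    have hs : ∀ A, D.cupAt A ≫ D.splitAt D.split (D.X ⊗ A) =
        D.cupAt A ≫ D.X ◁ D.splitAt D.split A := by
      intro A
      conv_lhs => rw [hω.splitAt_eq]
      rw [one_smul, ← reassoc_of% D.cupAt_naturality, splitAt_split,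
        MonoidalCategory.whiskerLeft_comp]
    rw [act_diagramH, ← Category.assoc, hs, Category.assoc,
      ← MonoidalCategory.whiskerLeft_comp, splitAt_mergeAt, hb']
    simp
  have h' := congrArg (fun g => g ≫ (α_ _ _ _).inv ≫ (ρ_ _).hom) h
  simpa [act, cupAt, unitors_inv_equal] using h'

end Rotate

end VertexData

/-! ### Linear algebra: an eigenvector among the linear relations -/

/-- Six vectors in dimension at most 5 are dependent. The matrix `M` lifts `r` to coefficient
vectors, so it preserves `ker E` and has an eigenvector there. -/
theorem exists_twisted_relation {V : Type*} [AddCommGroup V] [Module ℂ V]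
    (hV : Module.rank ℂ V ≤ 5) (r : V →ₗ[ℂ] V) {c : ℂ} (hc : c ≠ 0) {p q s x y z : V}
    (hp : r p = q) (hq : r q = s) (hs : r s = (c ^ 2)⁻¹ • p)
    (hx : r x = y) (hy : r y = c⁻¹ • z) (hz : r z = c⁻¹ • x) :
    ∃ v a α : ℂ, v ≠ 0 ∧ c = -v ^ 6 ∧ (a ≠ 0 ∨ α ≠ 0) ∧
      a • (v ^ (-3 : ℤ) • x + v • y - v ^ (-1 : ℤ) • z) +
        α • (q + v ^ (4 : ℤ) • s + v ^ (-4 : ℤ) • p) = 0 := by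
  let E : (Fin 6 → ℂ) →ₗ[ℂ] V := Fintype.linearCombination ℂ ![p, q, s, x, y, z]
  have hE : ∀ w : Fin 6 → ℂ, E w =
      w 0 • p + w 1 • q + w 2 • s + w 3 • x + w 4 • y + w 5 • z := by
    intro w
    simp [E, Fintype.linearCombination_apply, Fin.sum_univ_succ]
    abel
  let M : (Fin 6 → ℂ) →ₗ[ℂ] (Fin 6 → ℂ) :=
    { toFun := fun w => ![(c ^ 2)⁻¹ * w 2, w 0, w 1, c⁻¹ * w 5, w 3, c⁻¹ * w 4]
      map_add' := by
        intro w w'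
        ext i
        fin_cases i <;> simp [mul_add]
      map_smul' := by
        intro m w
        ext i
        fin_cases i <;> simp [mul_left_comm] }
  have hM : ∀ w, E (M w) = r (E w) := by
    intro w
    rw [hE, hE]
    simp only [map_add, map_smul, hp, hq, hs, hx, hy, hz, M, LinearMap.coe_mk, AddHom.coe_mk]
    simp
    module
  have hker : Nontrivial (LinearMap.ker E) := by
    rw [Submodule.nontrivial_iff_ne_bot]
    intro h
    have h1 := LinearMap.lift_rank_le_of_injective E (LinearMap.ker_eq_bot.mp h)
    have h2 := h1.trans (Cardinal.lift_le.mpr hV)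
    rw [rank_fin_fun] at h2
    simp only [Cardinal.lift_natCast, Cardinal.lift_ofNat] at h2
    norm_cast at h2
  have hinv : ∀ w ∈ LinearMap.ker E, M w ∈ LinearMap.ker E := by
    intro w hw
    rw [LinearMap.mem_ker] at hw ⊢
    rw [hM, hw, map_zero]
  obtain ⟨l, hl⟩ := Module.End.exists_eigenvalue (M.restrict hinv)
  obtain ⟨⟨w, hwE⟩, hw⟩ := hl.exists_hasEigenvector
  have hw0 : w ≠ 0 := by
    intro h
    exact hw.2 (by simpa using h)
  have hMw : M w = l • w := congrArg Subtype.val hw.apply_eq_smul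
  have e0 : (c ^ 2)⁻¹ * w 2 = l * w 0 := congrFun hMw 0
  have e1 : w 0 = l * w 1 := congrFun hMw 1
  have e2 : w 1 = l * w 2 := congrFun hMw 2
  have e3 : c⁻¹ * w 5 = l * w 3 := congrFun hMw 3
  have e4 : w 3 = l * w 4 := congrFun hMw 4
  have e5 : c⁻¹ * w 4 = l * w 5 := congrFun hMw 5
  have f0 : w 2 = c ^ 2 * l * w 0 := by field_simp at e0; linear_combination e0
  have f3 : w 5 = c * l * w 3 := by field_simp at e3; linear_combination e3
  have f5 : w 4 = c * l * w 5 := by field_simp at e5; linear_combination e5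
  -- On each 3-cycle `M ^ 3` is the scalar `c⁻²`; otherwise all coordinates would vanish.
  have hl3 : c ^ 2 * l ^ 3 = 1 := by
    by_contra h
    have h' : c ^ 2 * l ^ 3 - 1 ≠ 0 := sub_ne_zero.mpr h
    have g0 : w 0 = 0 := (mul_eq_zero.mp (by
      linear_combination -e1 - l * e2 - l ^ 2 * f0 : (c ^ 2 * l ^ 3 - 1) * w 0 = 0)).resolve_left h'
    have g3 : w 3 = 0 := (mul_eq_zero.mp (by
      linear_combination -e4 - l * f5 - c * l ^ 2 * f3 :
        (c ^ 2 * l ^ 3 - 1) * w 3 = 0)).resolve_left h'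
    have g2 : w 2 = 0 := by rw [f0, g0, mul_zero]
    have g1 : w 1 = 0 := by rw [e2, g2, mul_zero]
    have g5 : w 5 = 0 := by rw [f3, g3, mul_zero]
    have g4 : w 4 = 0 := by rw [f5, g5, mul_zero]
    apply hw0
    ext i
    fin_cases i <;> assumption
  have hl0 : l ≠ 0 := by
    rintro rfl
    simp at hl3
  -- With `c² l³ = 1`, this choice gives `v⁶ = -c³ l³ = -c` and `v⁴ = c² l² = l⁻¹`.
  obtain ⟨v, hv⟩ := IsAlgClosed.exists_pow_nat_eq (-c * l) (n := 2) (by norm_num)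
  have hv0 : v ≠ 0 := by
    rintro rfl
    have : c * l = 0 := by linear_combination hv
    exact (mul_ne_zero hc hl0) this
  have hv6 : c = -v ^ 6 := by
    linear_combination (-c) * hl3 + (v ^ 4 + v ^ 2 * (-c * l) + (-c * l) ^ 2) * hv
  have hv4 : l * v ^ 4 = 1 := by
    linear_combination hl3 + l * (v ^ 2 - c * l) * hv
  -- One coordinate in each cycle determines the eigenvector, so `w 3` and `w 1` are not both zero.
  -- The factor `v ^ 3` cancels the `v⁻³` in front of `x`.
  refine ⟨v, v ^ 3 * w 3, w 1, hv0, hv6, ?_, ?_⟩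
  · by_contra! h
    have g3 : w 3 = 0 := (mul_eq_zero.mp h.1).resolve_left (pow_ne_zero _ hv0)
    have g0 : w 0 = 0 := by rw [e1, h.2, mul_zero]
    have g1 := h.2
    have g2 : w 2 = 0 := by rw [f0, g0, mul_zero]
    have g5 : w 5 = 0 := by rw [f3, g3, mul_zero]
    have g4 : w 4 = 0 := by rw [f5, g5, mul_zero]
    apply hw0
    ext i
    fin_cases i <;> assumption
  · have h0 : E w = 0 := hwE
    rw [hE] at h0
    have hlv : v ^ (-4 : ℤ) = l := by
      rw [zpow_neg]
      exact inv_eq_of_mul_eq_one_left (by exact_mod_cast hv4)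
    have k2 : w 1 * v ^ (4 : ℤ) = w 2 := by
      have : v ^ (4 : ℤ) = v ^ 4 := by norm_cast
      rw [this]
      linear_combination v ^ 4 * e2 + w 2 * hv4
    have k0 : w 1 * v ^ (-4 : ℤ) = w 0 := by
      rw [hlv]
      linear_combination -e1
    have k3 : v ^ 3 * w 3 * v ^ (-3 : ℤ) = w 3 := by
      rw [zpow_neg]
      have : v ^ (3 : ℤ) = v ^ 3 := by norm_cast
      rw [this]
      field_simp
    have k4 : v ^ 3 * w 3 * v = w 4 := by
      linear_combination v ^ 4 * e4 + w 4 * hv4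
    have k5 : v ^ 3 * w 3 * v ^ (-1 : ℤ) = -w 5 := by
      rw [zpow_neg_one]
      field_simp
      linear_combination w 3 * hv + f3
    rw [← h0, ← k2, ← k0, ← k4, show w 5 = -(v ^ 3 * w 3 * v ^ (-1 : ℤ)) by rw [k5, neg_neg]]
    nth_rw 2 [← k3]
    module

/-! ### Morphisms determined by the small box spaces -/

namespace TrivalentRibbonCategory

variable {C : Type w₁} [Category.{w₂} C] [Preadditive C] [Linear ℂ C]
    [MonoidalCategory C] [MonoidalPreadditive C] [MonoidalLinear ℂ C] [BraidedCategory C]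
    [RightRigidCategory C] [RibbonCategory C] (T : TrivalentRibbonCategory C)

theorem cap_ne_zero : T.cap ≠ 0 := by
  intro h
  have := T.box_two.1 (a₁ := 0) (a₂ := 1) (by simp [h])
  simp at this

theorem vertex_ne_zero : T.τ ≠ 0 := by
  intro h
  have := T.box_three.1 (a₁ := 0) (a₂ := 1) (by simp [h])
  simp at this

theorem bend_symm_smul {Y Z : C} (r : ℂ) (f : Y ⟶ Z ⊗ T.X) :
    (T.bend Y Z).symm (r • f) = r • (T.bend Y Z).symm f := by
  simp [VertexData.bend_symm_apply]

theorem bend_symm_add {Y Z : C} (f g : Y ⟶ Z ⊗ T.X) :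
    (T.bend Y Z).symm (f + g) = (T.bend Y Z).symm f + (T.bend Y Z).symm g := by
  simp [VertexData.bend_symm_apply]

theorem bend_smul {Y Z : C} (r : ℂ) (f : Y ⊗ T.X ⟶ Z) :
    T.bend Y Z (r • f) = r • T.bend Y Z f := by
  simp [VertexData.bend_apply]

theorem exists_eq_smul_cap (f : T.X ⊗ T.X ⟶ 𝟙_ C) : ∃ r : ℂ, f = r • T.cap := by
  obtain ⟨r, hr⟩ := T.box_two.2 f
  exact ⟨r, hr.symm⟩

theorem exists_eq_smul_merge (f : T.X ⊗ T.X ⟶ T.X) : ∃ r : ℂ, f = r • T.merge := by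
  obtain ⟨r, hr⟩ := T.box_three.2 ((T.bend (T.X ⊗ T.X) (𝟙_ C)).symm (f ≫ (λ_ _).inv))
  refine ⟨r, ?_⟩
  have h : r • T.τ = _ := hr
  rw [T.merge_eq_bend, ← Linear.smul_comp, ← bend_smul, h]
  simp

theorem exists_eq_smul_id (f : T.X ⟶ T.X) : ∃ r : ℂ, f = r • 𝟙 T.X := by
  obtain ⟨r, hr⟩ := T.exists_eq_smul_cap ((T.bend T.X (𝟙_ C)).symm (f ≫ (λ_ _).inv))
  have hcap : (T.bend T.X (𝟙_ C)).symm (λ_ T.X).inv = T.cap := by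
    simp [VertexData.bend_symm_apply, unitors_inv_equal]
  rw [← hcap, ← bend_symm_smul] at hr
  refine ⟨r, ?_⟩
  rw [← cancel_mono (λ_ T.X).inv, (T.bend _ _).symm.injective hr]
  simp

theorem exists_eq_smul_cup (f : 𝟙_ C ⟶ T.X ⊗ T.X) : ∃ r : ℂ, f = r • T.cup := by
  obtain ⟨r, hr⟩ := T.exists_eq_smul_id ((λ_ _).inv ≫ (T.bend (𝟙_ C) T.X).symm f)
  have hcup : T.bend (𝟙_ C) T.X (λ_ T.X).hom = T.cup := by
    simp [VertexData.bend_apply, unitors_equal]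
  refine ⟨r, ?_⟩
  rw [← hcup, ← bend_smul, ← Equiv.symm_apply_eq, ← cancel_epi (λ_ T.X).inv, hr]
  simp

theorem lollipop_eq_zero : T.lollipop = 0 := by
  have h := T.box_one ((λ_ _).inv ≫ (T.bend (𝟙_ C) (𝟙_ C)).symm (T.lollipop ≫ (λ_ _).inv))
  rw [Preadditive.IsIso.comp_left_eq_zero] at h
  have h' := congrArg (T.bend (𝟙_ C) (𝟙_ C)) h
  simpa [VertexData.bend_apply] using h'

theorem rank_hom_le (hdim : Module.rank ℂ (Box T.X 4) ≤ 5) :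
    Module.rank ℂ (T.X ⊗ T.X ⟶ T.X ⊗ T.X) ≤ 5 := by
  let ι : (T.X ⊗ T.X ⟶ T.X ⊗ T.X) →ₗ[ℂ] Box T.X 4 :=
    { toFun := fun f => (T.bend ((T.X ⊗ T.X) ⊗ T.X) (𝟙_ C)).symm
        ((T.bend (T.X ⊗ T.X) (𝟙_ C ⊗ T.X)).symm (f ≫ (λ_ T.X).inv ▷ T.X))
      map_add' := by
        intro f g
        simp [bend_symm_add]
      map_smul' := by
        intro r f
        simp [bend_symm_smul] }
  refine (LinearMap.rank_le_of_injective ι ?_).trans hdim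
  intro f g h
  have := (T.bend _ _).symm.injective ((T.bend _ _).symm.injective h)
  simpa using this

end TrivalentRibbonCategory

/-! ### The Jacobi relation and its degenerate case -/

namespace VertexData

variable {C : Type w₁} [Category.{w₂} C] [Preadditive C] [Linear ℂ C]
    [MonoidalCategory C] [BraidedCategory C] [RightRigidCategory C]

/-- The values of the circle, the bigon, the triangle and the twist of the vertex, for a vertex
that is invariant under rotation. -/
structure HasScalars (D : VertexData C) (d b t c : ℂ) : Prop where
  circle : D.circle = d • 𝟙 (𝟙_ C)
  lollipop : D.lollipop = 0
  bigon : D.bigon = b • 𝟙 D.X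
  triangle : D.triangle = t • D.merge
  twistedVertex : D.twistedVertex = c • D.merge
  twistedCup : D.twistedCup = c ^ 2 • D.cup
  twistedCap : D.crossing ≫ D.cap = c ^ 2 • D.cap
  rotatesBy_one : D.RotatesBy 1
  bigon_ne_zero : b ≠ 0
  twist_ne_zero : c ≠ 0
  cup_ne_zero : D.cup ≠ 0
  merge_ne_zero : D.merge ≠ 0

omit [Preadditive C] [Linear ℂ C] in
theorem braiding_crossing (D : VertexData C) : (β_ D.X D.X).hom ≫ D.crossing = 𝟙 _ := by
  simp [crossing]

omit [Preadditive C] [Linear ℂ C] in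
theorem crossing_braiding (D : VertexData C) : D.crossing ≫ (β_ D.X D.X).hom = 𝟙 _ := by
  simp [crossing]

theorem rotate_crossing [MonoidalPreadditive C] [MonoidalLinear ℂ C] (D : VertexData C) :
    D.rotate D.crossing = (β_ D.X D.X).hom :=
  rotate_crossing_eq D.isCrossing_braiding_inv (braiding_crossing D)

theorem rotate_braiding [MonoidalPreadditive C] [MonoidalLinear ℂ C] (D : VertexData C) :
    D.rotate (β_ D.X D.X).hom = D.crossing :=
  rotate_crossing_eq D.isCrossing_braiding (crossing_braiding D)

namespace HasScalars

variable {D : VertexData C} {d b t c : ℂ} (h : D.HasScalars d b t c)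

include h

theorem diagramI_merge : D.diagramI ≫ D.merge = b • D.merge := by
  have hb : D.split ≫ D.merge = b • 𝟙 D.X := h.bigon
  simp [diagramI, hb]

theorem cupcap_merge : D.cupcap ≫ D.merge = 0 := by
  have hl : D.cup ≫ D.merge = 0 := h.lollipop
  simp [cupcap, hl]

theorem diagramH_merge : D.diagramH ≫ D.merge = t • D.merge := h.triangle

theorem crossing_merge : D.crossing ≫ D.merge = c • D.merge := h.twistedVertex

theorem diagramX_merge : D.diagramX ≫ D.merge = (c * t) • D.merge := by
  simp [diagramX, h.diagramH_merge, h.crossing_merge, smul_smul, mul_comm]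

theorem cup_diagramI : D.cup ≫ D.diagramI = 0 := by
  have hl : D.cup ≫ D.merge = 0 := h.lollipop
  simp [diagramI, reassoc_of% hl]

theorem cup_cupcap : D.cup ≫ D.cupcap = d • D.cup := by
  have hd : D.cup ≫ D.cap = d • 𝟙 _ := h.circle
  simp [cupcap, reassoc_of% hd]

theorem cup_crossing : D.cup ≫ D.crossing = c ^ 2 • D.cup := h.twistedCup

theorem diagramH_diagramI : D.diagramH ≫ D.diagramI = t • D.diagramI := by
  have := h.diagramH_merge
  simp [diagramI, reassoc_of% this]

theorem braiding_merge : (β_ D.X D.X).hom ≫ D.merge = c⁻¹ • D.merge := by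
  have := congrArg (fun g => c⁻¹ • (β_ D.X D.X).hom ≫ g) h.crossing_merge
  simpa [reassoc_of% D.braiding_crossing, smul_smul, h.twist_ne_zero] using this.symm

theorem braiding_cap : (β_ D.X D.X).hom ≫ D.cap = (c ^ 2)⁻¹ • D.cap := by
  have := congrArg (fun g => (c ^ 2)⁻¹ • (β_ D.X D.X).hom ≫ g) h.twistedCap
  simpa [reassoc_of% D.braiding_crossing, smul_smul, h.twist_ne_zero] using this.symm

variable [MonoidalPreadditive C] [MonoidalLinear ℂ C]

theorem cup_diagramH : D.cup ≫ D.diagramH = b • D.cup :=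
  h.rotatesBy_one.cup_comp_diagramH h.bigon

theorem cup_diagramX : D.cup ≫ D.diagramX = (c ^ 2 * b) • D.cup := by
  have hc := h.cup_crossing
  simp [diagramX, reassoc_of% hc, h.cup_diagramH, smul_smul]

theorem cupcap_diagramH : D.cupcap ≫ D.diagramH = b • D.cupcap := by
  simp [cupcap, h.cup_diagramH]

theorem diagramH_cupcap : D.diagramH ≫ D.cupcap = b • D.cupcap := by
  have := h.rotatesBy_one.diagramH_comp_cap h.bigon
  simp [cupcap, reassoc_of% this]

theorem rotate_braiding_diagramH :
    D.rotate ((β_ D.X D.X).hom ≫ D.diagramH) = c⁻¹ • D.diagramX :=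
  h.rotatesBy_one.rotate_crossing_comp_diagramH D.isCrossing_braiding (crossing_braiding D)
    h.braiding_merge

/-- The relation determined by the twist, up to the ratio of its two halves. -/
theorem exists_relation (hdim : Module.rank ℂ (D.X ⊗ D.X ⟶ D.X ⊗ D.X) ≤ 5) :
    ∃ v a α : ℂ, v ≠ 0 ∧ c = -v ^ 6 ∧ (a ≠ 0 ∨ α ≠ 0) ∧
      a • (v ^ (-3 : ℤ) • D.diagramX + v • D.diagramI - v ^ (-1 : ℤ) • D.diagramH) +
        α • (D.crossing + v ^ (4 : ℤ) • D.cupcap + v ^ (-4 : ℤ) • 𝟙 (D.X ⊗ D.X)) = 0 := by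
  -- The operator is precomposition with the braiding followed by a quarter turn, cycling `1 → σ →
  -- cup ∘ cap` and `K → I → H`.
  refine exists_twisted_relation hdim
    (D.rotate ∘ₗ Linear.leftComp ℂ (D.X ⊗ D.X) (β_ D.X D.X).hom) h.twist_ne_zero ?_ ?_ ?_ ?_ ?_ ?_
  · simp [rotate_braiding]
  · simp [D.braiding_crossing, rotate_id]
  · have := h.braiding_cap
    simp only [LinearMap.comp_apply, Linear.leftComp_apply, cupcap, reassoc_of% this,
      Linear.smul_comp, map_smul]
    rw [← cupcap, rotate_cupcap]
  · simp [diagramX, reassoc_of% D.braiding_crossing, h.rotatesBy_one.rotate_diagramH]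
  · have := h.braiding_merge
    simp only [LinearMap.comp_apply, Linear.leftComp_apply, diagramI, reassoc_of% this,
      Linear.smul_comp, map_smul]
    rw [← diagramI, h.rotatesBy_one.rotate_diagramI]
  · simp [h.rotate_braiding_diagramH]

/-- Closing a relation with a cup and with a vertex. -/
theorem closures {x y z p q s : ℂ}
    (hrel : x • D.diagramX + y • D.diagramI + z • D.diagramH + q • D.crossing + s • D.cupcap +
      p • 𝟙 (D.X ⊗ D.X) = 0) :
    x * c ^ 2 * b + z * b + q * c ^ 2 + s * d + p = 0 ∧
      x * c * t + y * b + z * t + q * c + p = 0 := by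
  constructor
  · have h1 := congrArg (fun g => D.cup ≫ g) hrel
    simp only [Preadditive.comp_add, Linear.comp_smul, h.cup_diagramX, h.cup_diagramI,
      h.cup_diagramH, h.cup_crossing, h.cup_cupcap, Category.comp_id, Limits.comp_zero] at h1
    have h2 : (x * c ^ 2 * b + z * b + q * c ^ 2 + s * d + p) • D.cup = 0 := by
      rw [← h1]; module
    exact (smul_eq_zero.mp h2).resolve_right h.cup_ne_zero
  · have h1 := congrArg (fun g => g ≫ D.merge) hrel
    simp only [Preadditive.add_comp, Linear.smul_comp, h.diagramX_merge, h.diagramI_merge,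
      h.diagramH_merge, h.crossing_merge, h.cupcap_merge, Category.id_comp,
      Limits.zero_comp] at h1
    have h2 : (x * c * t + y * b + z * t + q * c + p) • D.merge = 0 := by
      rw [← h1]; module
    exact (smul_eq_zero.mp h2).resolve_right h.merge_ne_zero

/-- When the crossing is a combination of the planar diagrams without vertices, so is the sum of
a multiple of `I` and `H`. -/
theorem planar_relation {u : ℂ} (hu : u ^ 5 = 1) (hc : c = -u ^ 3)
    (hσ : D.crossing = -u ^ 2 • D.cupcap - u ^ 3 • 𝟙 _) :
    D.diagramH + u ^ 2 • D.diagramI + b • (u ^ 3 • 𝟙 _ + u ^ 4 • D.cupcap) = 0 := by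
  have hβ : (β_ D.X D.X).hom = -u ^ 2 • 𝟙 _ - u ^ 3 • D.cupcap := by
    rw [← rotate_crossing, hσ, map_sub, map_smul, map_smul, rotate_id, rotate_cupcap]
  -- The quarter turn of `H` with braided legs is a multiple of `K`; expanding both crossings into
  -- planar diagrams makes this a relation between `H`, `I`, `1` and `cup ∘ cap`.
  have h1 := h.rotate_braiding_diagramH
  have hci : c⁻¹ = -u ^ 2 := by
    rw [inv_eq_iff_eq_inv, eq_comm]
    exact inv_eq_of_mul_eq_one_left (by rw [hc]; linear_combination hu)
  rw [hβ, diagramX, hσ, hci] at h1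
  simp only [Preadditive.sub_comp, Linear.smul_comp, Category.id_comp, h.cupcap_diagramH, map_sub,
    map_smul, h.rotatesBy_one.rotate_diagramH, rotate_cupcap] at h1
  have h2 : D.diagramH + u ^ 2 • D.diagramI + b • (u ^ 3 • 𝟙 _ + u ^ 4 • D.cupcap) =
      -(((-u ^ 2) • D.diagramI - u ^ 3 • b • 𝟙 _) -
        (-u ^ 2) • ((-u ^ 2) • b • D.cupcap - u ^ 3 • D.diagramH)) +
        (1 - u ^ 5) • D.diagramH := by
    module
  rw [h2, h1, hu]
  simp

/-- Multiplying the relation by `H` produces the square. The square is rotation invariant, so it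
cancels against the quarter turn of the product; closing with a vertex, where `t = -2b`, leaves `-10
b² = 0`. -/
theorem planar_relation_false
    (hrel : D.diagramH + D.diagramI + b • (𝟙 _ + D.cupcap) = 0) : False := by
  have h1 := congrArg (fun g => D.diagramH ≫ g) hrel
  simp only [Preadditive.comp_add, Linear.comp_smul, h.diagramH_diagramI, h.diagramH_cupcap,
    Category.comp_id, Limits.comp_zero] at h1
  have h2 := congrArg D.rotate h1
  simp only [map_add, map_smul, map_zero, h.rotatesBy_one.rotate_diagramH_comp_diagramH,
    h.rotatesBy_one.rotate_diagramH, h.rotatesBy_one.rotate_diagramI, rotate_cupcap] at h2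
  have h3 : (0 : ℂ) • D.diagramX + (t - b) • D.diagramI + (b - t) • D.diagramH +
      (0 : ℂ) • D.crossing + b ^ 2 • D.cupcap + (-b ^ 2) • 𝟙 _ = 0 := by
    rw [← sub_eq_zero.mpr (h1.trans h2.symm)]
    module
  have h4 : (0 : ℂ) • D.diagramX + (1 : ℂ) • D.diagramI + (1 : ℂ) • D.diagramH +
      (0 : ℂ) • D.crossing + b • D.cupcap + b • 𝟙 _ = 0 := by
    rw [← hrel]
    module
  have e3 := (h.closures h3).2
  have e4 := (h.closures h4).2
  have ht : t = -2 * b := by linear_combination e4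
  rw [ht] at e3
  apply h.bigon_ne_zero
  have : b ^ 2 = 0 := by linear_combination (-1 / 10 : ℂ) * e3
  exact pow_eq_zero_iff (two_ne_zero) |>.mp this

/-- When the crossing is a combination of the planar diagrams without vertices, the exceptional
relation holds without its second half. -/
theorem exceptional_relation_of_planar {v : ℂ} (hv : v ≠ 0) (hc : c = -v ^ 6)
    (hrel : D.crossing + v ^ (4 : ℤ) • D.cupcap + v ^ (-4 : ℤ) • 𝟙 (D.X ⊗ D.X) = 0) :
    v ^ (-3 : ℤ) • D.diagramX + v • D.diagramI - v ^ (-1 : ℤ) • D.diagramH = 0 := by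
  -- Closing with a vertex gives `c + v⁻⁴ = 0`, hence `v¹⁰ = 1`; negative powers of `v` can then be
  -- made positive.
  have hz := (h.closures (x := 0) (y := 0) (z := 0) (q := 1) (s := v ^ (4 : ℤ))
    (p := v ^ (-4 : ℤ)) (by rw [← hrel]; module)).2
  have hv10 : v ^ 10 = 1 := by
    rw [hc, zpow_neg] at hz
    norm_cast at hz
    field_simp at hz
    linear_combination -hz
  have hu : (v ^ 2) ^ 5 = 1 := by rw [← pow_mul, hv10]
  have hv4 : v ^ (-4 : ℤ) = (v ^ 2) ^ 3 := by
    rw [zpow_neg]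
    norm_cast
    exact inv_eq_of_mul_eq_one_left (by linear_combination hv10)
  have hv3 : v ^ (-3 : ℤ) = v ^ 7 := by
    rw [zpow_neg]
    norm_cast
    exact inv_eq_of_mul_eq_one_left (by linear_combination hv10)
  have hv1 : v ^ (-1 : ℤ) = v ^ 9 := by
    rw [zpow_neg]
    norm_cast
    exact inv_eq_of_mul_eq_one_left (by linear_combination hv10)
  have hσ : D.crossing = -(v ^ 2) ^ 2 • D.cupcap - (v ^ 2) ^ 3 • 𝟙 _ := by
    rw [hv4] at hrel
    have : v ^ (4 : ℤ) = (v ^ 2) ^ 2 := by norm_cast; ring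
    rw [this] at hrel
    rw [eq_sub_iff_add_eq, neg_smul, eq_neg_iff_add_eq_zero, ← hrel]
    module
  have r1 := h.planar_relation hu (by rw [hc]; ring) hσ
  rw [hv3, hv1, diagramX, hσ, Preadditive.sub_comp, Linear.smul_comp, Linear.smul_comp,
    h.cupcap_diagramH, Category.id_comp]
  have hv7 : v ^ 7 = v * (v ^ 2) ^ 3 := by ring
  have hv9 : v ^ 9 = v * (v ^ 2) ^ 4 := by ring
  rw [hv7, hv9]
  generalize v ^ 2 = u at *
  have hu1 : u ≠ 1 := by
    intro hu1
    rw [hu1] at r1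
    simp only [one_pow, one_smul] at r1
    exact h.planar_relation_false r1
  have r2 := congrArg D.rotate r1
  simp only [map_add, map_smul, map_zero, h.rotatesBy_one.rotate_diagramH,
    h.rotatesBy_one.rotate_diagramI, rotate_cupcap, rotate_id] at r2
  have hu3 : u ^ 3 - 1 ≠ 0 := by
    intro h3
    apply hu1
    linear_combination (u ^ 3 + 1) * h3 - u * hu
  refine (smul_eq_zero.mp ?_).resolve_left hu3
  -- The goal has no identity term, so `u` times the planar relation minus its quarter turn is used:
  -- there the identity cancels. The last summand vanishes because `u ^ 5 = 1`.
  have key : (u ^ 3 - 1) • ((v * u ^ 3) • ((-u ^ 2) • b • D.cupcap - u ^ 3 • D.diagramH) +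
      v • D.diagramI - (v * u ^ 4) • D.diagramH) =
      v • (u • (D.diagramH + u ^ 2 • D.diagramI + b • (u ^ 3 • 𝟙 _ + u ^ 4 • D.cupcap)) -
        (D.diagramI + u ^ 2 • D.diagramH + b • (u ^ 3 • D.cupcap + u ^ 4 • 𝟙 _))) +
      (u ^ 5 - 1) • ((v * (-u ^ 4 - u ^ 2 + u)) • D.diagramH - (v * b * u ^ 3) • D.cupcap) := by
    module
  rw [key, r1, r2, hu]
  simp

end HasScalars
end VertexData

/-! ### Rotation invariance and the scalars of a trivalent category -/

namespace TrivalentRibbonCategory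

variable {C : Type w₁} [Category.{w₂} C] [Preadditive C] [Linear ℂ C]
    [MonoidalCategory C] [MonoidalPreadditive C] [MonoidalLinear ℂ C] [BraidedCategory C]
    [RightRigidCategory C] [RibbonCategory C] (T : TrivalentRibbonCategory C)

theorem merge_ne_zero : T.merge ≠ 0 := by
  intro h
  apply T.vertex_ne_zero
  have h' : T.bend (T.X ⊗ T.X) (𝟙_ C) T.τ = T.bend (T.X ⊗ T.X) (𝟙_ C) 0 := by
    rw [T.merge_eq_bend, Preadditive.IsIso.comp_right_eq_zero] at h
    rw [h]
    simp [VertexData.bend_apply]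
  exact (T.bend _ _).injective h'

theorem merge_whiskerRight_cap : T.merge ▷ T.X ≫ T.cap = T.τ := by
  have h : T.τ = (T.bend (T.X ⊗ T.X) (𝟙_ C)).symm (T.merge ≫ (λ_ T.X).inv) := by
    rw [T.merge_eq_bend]
    simp
  rw [h]
  simp [VertexData.bend_symm_apply, unitors_inv_equal]

theorem mergeAt_capAt (A : C) :
    T.mergeAt T.merge (T.X ⊗ A) ≫ T.capAt A =
      (α_ _ _ _).inv ≫ (α_ _ _ _).inv ≫ T.τ ▷ A ≫ (λ_ A).hom := by
  rw [← merge_whiskerRight_cap]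
  simp only [VertexData.mergeAt, VertexData.capAt]
  monoidal

theorem mergeAt_capAt_ne_zero :
    T.mergeAt T.merge (T.X ⊗ 𝟙_ C) ≫ T.capAt (𝟙_ C) ≠ 0 := by
  rw [mergeAt_capAt]
  intro h
  apply T.vertex_ne_zero
  simpa using h

theorem exists_rotatesBy : ∃ ω : ℂ, T.RotatesBy ω := by
  obtain ⟨ω, hω⟩ := T.box_three.2 ((α_ _ _ _).hom ≫ T.X ◁ T.merge ≫ T.cap)
  refine ⟨ω, fun A => ?_⟩
  have h : ω • T.τ = _ := hω
  have h' := congrArg (fun g => (α_ _ _ _).inv ≫ (α_ _ _ _).inv ≫ g ▷ A ≫ (λ_ A).hom) h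
  rw [mergeAt_capAt]
  simp only [MonoidalLinear.smul_whiskerRight, Linear.smul_comp, Linear.comp_smul] at h'
  rw [h']
  simp only [VertexData.mergeAt, VertexData.capAt]
  monoidal

theorem exists_hasScalars : ∃ d b t c : ℂ, T.HasScalars d b t c := by
  obtain ⟨d, hd, hcircle⟩ := T.circle_ne_zero
  obtain ⟨b, hb, hbigon⟩ := T.bigon_ne_zero
  obtain ⟨t, ht⟩ := T.exists_eq_smul_merge T.triangle
  obtain ⟨c, hc⟩ := T.exists_eq_smul_merge T.twistedVertex
  obtain ⟨k, hk⟩ := T.exists_eq_smul_cap (T.crossing ≫ T.cap)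
  obtain ⟨l, hl⟩ := T.exists_eq_smul_cup T.twistedCup
  obtain ⟨ω, hω⟩ := T.exists_rotatesBy
  have hcircle' : T.cup ≫ T.cap = d • 𝟙 _ := hcircle
  have hid : 𝟙 (𝟙_ C) ≠ 0 := by
    intro h0
    have := T.box_zero.1 (a₁ := 0) (a₂ := 1) (by simp [h0])
    simp at this
  have hcup : T.cup ≠ 0 := by
    intro h0
    rw [h0, Limits.zero_comp, eq_comm, smul_eq_zero] at hcircle'
    exact hcircle'.elim hd hid
  -- Both are the factor of a circle with one kink, and the circle is non-zero.
  have hlk : l = k := by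
    have h1 : T.twistedCup ≫ T.cap = T.cup ≫ T.crossing ≫ T.cap := by
      simp [VertexData.twistedCup]
    rw [hl, hk, Linear.smul_comp, Linear.comp_smul, hcircle', smul_smul, smul_smul] at h1
    exact mul_right_cancel₀ hd (smul_left_injective ℂ hid h1)
  have hβ := T.braiding_crossing
  have hc0 : c ≠ 0 := by
    rintro rfl
    apply T.merge_ne_zero
    have h1 : T.crossing ≫ T.merge = _ := hc
    have := congrArg (fun g => (β_ T.X T.X).hom ≫ g) h1
    simpa [reassoc_of% hβ] using this
  have hk0 : k ≠ 0 := by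
    rintro rfl
    apply T.cap_ne_zero
    have := congrArg (fun g => (β_ T.X T.X).hom ≫ g) hk
    simpa [reassoc_of% hβ] using this
  have hω3 := hω.pow_three hb hbigon T.cap_ne_zero
  have hω0 : ω ≠ 0 := by
    rintro rfl
    simp at hω3
  have e1 : k * ω = c ^ 2 :=
    hω.mul_eq T.isCrossing_braiding_inv hc hk T.mergeAt_capAt_ne_zero hω0
  have e2 : k⁻¹ * ω = c⁻¹ ^ 2 := by
    refine hω.mul_eq T.isCrossing_braiding ?_ ?_ T.mergeAt_capAt_ne_zero hω0
    · have h1 : T.crossing ≫ T.merge = _ := hc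
      have := congrArg (fun g => c⁻¹ • (β_ T.X T.X).hom ≫ g) h1
      simpa [reassoc_of% hβ, smul_smul, hc0] using this.symm
    · have := congrArg (fun g => k⁻¹ • (β_ T.X T.X).hom ≫ g) hk
      simpa [reassoc_of% hβ, smul_smul, hk0] using this.symm
  -- Multiplying the identities for the two crossings gives `ω² = 1`; together with `ω³ = 1` this
  -- forces `ω = 1`, and then `k = c²`.
  have hω1 : ω = 1 := by
    have hω2 : ω ^ 2 = 1 := by
      calc ω ^ 2 = (k * ω) * (k⁻¹ * ω) := by field_simp
        _ = 1 := by rw [e1, e2]; field_simp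
    linear_combination hω3 - ω * hω2
  subst hω1
  have hkc : k = c ^ 2 := by rw [← e1, mul_one]
  rw [hlk, hkc] at hl
  rw [hkc] at hk
  exact ⟨d, b, t, c, hcircle, T.lollipop_eq_zero, hbigon, ht, hc, hl, hk, hω, hb, hc0, hcup,
    T.merge_ne_zero⟩

end TrivalentRibbonCategory
end QuantumExceptional

/-! ### The main theorem -/

open QuantumExceptional
theorem theorem1p9 {C : Type w₁} [Category.{w₂} C] [Preadditive C] [Linear ℂ C]
    [MonoidalCategory C] [MonoidalPreadditive C] [MonoidalLinear ℂ C] [BraidedCategory C]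
    [RightRigidCategory C] [RibbonCategory C] (T : TrivalentRibbonCategory C)
    (hdim : Module.rank ℂ (Box T.X 4) ≤ 5) :
    ∃ v α b d t : ℂ, v ≠ 0 ∧
      T.circle = d • 𝟙 (𝟙_ C) ∧
      T.lollipop = 0 ∧
      T.bigon = b • 𝟙 T.X ∧
      T.triangle = t • T.merge ∧
      T.twistedVertex = (-v ^ 6) • T.merge ∧
      T.twistedCup = (v ^ 12) • T.cup ∧
      qBracket v 5 * b = -α * (d + qBrace v 8) ∧
      qBrace v 2 * t = b - qBracket v 5 * α ∧
      v ^ (-3 : ℤ) • T.diagramX + v • T.diagramI - v ^ (-1 : ℤ) • T.diagramH +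
        α • (T.crossing + v ^ (4 : ℤ) • T.cupcap + v ^ (-4 : ℤ) • 𝟙 (T.X ⊗ T.X)) = 0 := by
  obtain ⟨d, b, t, c, h⟩ := T.exists_hasScalars
  obtain ⟨v, a, α, hv, hc, ha, hrel⟩ := h.exists_relation (T.rank_hom_le hdim)
  have hmain : ∃ α : ℂ,
      v ^ (-3 : ℤ) • T.diagramX + v • T.diagramI - v ^ (-1 : ℤ) • T.diagramH +
        α • (T.crossing + v ^ (4 : ℤ) • T.cupcap + v ^ (-4 : ℤ) • 𝟙 (T.X ⊗ T.X)) = 0 := by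
    -- For `a = 0` the half without vertices vanishes, and the degenerate case supplies the relation
    -- with `α = 0`; otherwise divide by `a`.
    by_cases ha0 : a = 0
    · have hα : α ≠ 0 := ha.resolve_left (not_not.mpr ha0)
      rw [ha0, zero_smul, zero_add] at hrel
      refine ⟨0, ?_⟩
      rw [h.exceptional_relation_of_planar hv hc ((smul_eq_zero.mp hrel).resolve_left hα),
        zero_smul, zero_add]
    · refine ⟨a⁻¹ * α, ?_⟩
      have := congrArg (fun g => a⁻¹ • g) hrel
      simpa only [smul_add, smul_sub, smul_smul, inv_mul_cancel_left₀ ha0, inv_mul_cancel₀ ha0,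
        one_mul, one_smul, smul_zero, mul_assoc] using this
  obtain ⟨α, hα⟩ := hmain
  -- After `c = -v⁶`, the cup closure `e1` is the equation for `[5] b` and the vertex closure `e2`
  -- the one for `{2} t`.
  obtain ⟨e1, e2⟩ := h.closures (x := v ^ (-3 : ℤ)) (y := v) (z := -v ^ (-1 : ℤ)) (q := α)
    (s := α * v ^ (4 : ℤ)) (p := α * v ^ (-4 : ℤ)) (by rw [← hα]; module)
  refine ⟨v, α, b, d, t, hv, h.circle, h.lollipop, h.bigon, h.triangle, ?_, ?_, ?_, ?_, hα⟩
  · rw [h.twistedVertex, hc]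
  · rw [h.twistedCup, hc]
    congr 1
    ring
  · rw [hc] at e1
    simp only [qBracket, qBrace, zpow_neg] at e1 ⊢
    norm_cast at e1 ⊢
    field_simp at e1 ⊢
    linear_combination e1
  · rw [hc] at e2
    simp only [qBracket, qBrace, zpow_neg] at e2 ⊢
    norm_cast at e2 ⊢
    field_simp at e2 ⊢
    linear_combination -e2
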